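/- Let $n \geq 2$. Let $\operatorname{P}(n)$ be the set of rank-deficient nonzero orthogonal projections in $\mathbb{R}^{n\times n}$ (i.e., the orthogonal projections onto proper nontrivial subspaces of $\mathbb{R}^n$), and let $\operatorname{S}(n) \supseteq \operatorname{P}(n)$ be the set of rank-deficient nonzero symmetric positive semidefinite matrices in $\mathbb{R}^{n\times n}$. The Naimark complement is the map $N\colon \operatorname{P}(n)\to\operatorname{P}(n)$, $N(P)=I-P$. For $A\in\mathbb{R}^{n\times n}$, the matroid represented by the columns of $A$ is the matroid on $\{1,\ldots,n\}$ whose bases are the subsets that index a basis of the span of the columns of $A$; the dual of a matroid is the matroid on the same ground set whose bases are the complements of the bases. Consider the following properties of an extension $E\colon\operatorname{S}(n)\to\operatorname{S}(n)$ of $N$ (i.e., a map with $E(P)=N(P)$ for every $P\in\operatorname{P}(n)$): (a) $E$ is stratum-wise continuous: for every $d\in\{1,\ldots,n-1\}$, the restriction of $E$ to the set of rank-$d$ matrices in $\operatorname{S}(n)$ is continuous (for the topology of $\mathbb{R}^{n\times n}$); (b) $E$ is involutive: $E(E(A))=A$ for every $A\in\operatorname{S}(n)$; (c) $E$ is Gale: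 for every $A\in\operatorname{S}(n)$, the matroid represented by the columns of $E(A)$ is the dual of the matroid represented by the columns of $A$. Then there is an extension of $N$ to $\operatorname{S}(n)$ that satisfies (a), (b) and (c) if and only if $n=2$. Moreover, for every $n\geq 2$ and any two of (a), (b), (c), there is an extension of $N$ to $\operatorname{S}(n)$ that satisfies these two. Specifically, writing $\lambda_{\max}(A)$ for the largest eigenvalue of $A$, the map $A\mapsto\lambda_{\max}(A)I-A$ is an extension of $N$ to a map $\operatorname{S}(n)\to\operatorname{S}(n)$ that satisfies (a) and (b); the map that sends $A$ to the orthogonal projection onto the kernel of $A$ is an extension of $N$ to a map $\operatorname{S}(n)\to\operatorname{S}(n)$ that satisfies (a) and (c); and there is an extension of $N$ to $\operatorname{S}(n)$ that satisfies (b) and (c). -/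

import Mathlib

namespace NaimarkExt

/-- `P(n)`: the rank-deficient nonzero orthogonal projections in `ℝ^{n × n}`, i.e. the orthogonal
projections onto the proper nontrivial subspaces of `ℝⁿ`
(`IsStarProjection P` says that `P * P = P` and that `P` is symmetric). -/
def projections (n : ℕ) : Set (Matrix (Fin n) (Fin n) ℝ) :=
  {P | IsStarProjection P ∧ P ≠ 0 ∧ P.rank < n}

/-- `S(n)`: the rank-deficient nonzero (symmetric) positive semidefinite `n × n` matrices. -/
def psdMatrices (n : ℕ) : Set (Matrix (Fin n) (Fin n) ℝ) :=
  {A | A.PosSemidef ∧ A ≠ 0 ∧ A.rank < n}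

theorem projections_subset_psdMatrices (n : ℕ) : projections n ⊆ psdMatrices n := by
  rintro P ⟨hP, h0, hr⟩
  refine ⟨?_, h0, hr⟩
  have h : P = P.conjTranspose * P := by
    have h1 : P.conjTranspose = P := hP.isSelfAdjoint
    rw [h1]
    exact hP.isIdempotentElem.symm
  rw [h]
  exact Matrix.posSemidef_conjTranspose_mul_self P

theorem one_sub_mem_projections {n : ℕ} {P : Matrix (Fin n) (Fin n) ℝ}
    (hP : P ∈ projections n) : 1 - P ∈ projections n := by
  obtain ⟨hP, h0, hr⟩ := hP
  refine ⟨hP.one_sub, ?_, ?_⟩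
  · intro h
    rw [← sub_eq_zero.mp h, Matrix.rank_one, Fintype.card_fin] at hr
    exact lt_irrefl n hr
  · by_contra hn
    have hle : (1 - P).rank ≤ n := by simpa using (1 - P).rank_le_card_width
    have hrk : (1 - P).rank = n := le_antisymm hle (not_lt.mp hn)
    have hu : IsUnit (1 - P) := by
      rw [← Matrix.linearIndependent_cols_iff_isUnit,
        linearIndependent_iff_card_eq_finrank_span, Fintype.card_fin, Set.finrank,
        ← Matrix.rank_eq_finrank_span_cols, hrk]
    apply h0
    have hz : P * (1 - P) = 0 := by
      rw [mul_sub, mul_one, hP.isIdempotentElem.eq, sub_self]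
    exact (hu.mul_left_eq_zero).mp hz

/-- The Naimark complement `N : P(n) → P(n)`, `N(P) = I - P`. -/
def naimark {n : ℕ} (P : projections n) : projections n :=
  ⟨1 - (P : Matrix (Fin n) (Fin n) ℝ), one_sub_mem_projections P.2⟩

/-- `E : S(n) → S(n)` extends the Naimark complement: `E(P) = N(P)` for every `P ∈ P(n)`. -/
def ExtendsNaimark {n : ℕ} (E : psdMatrices n → psdMatrices n) : Prop :=
  ∀ P : projections n,
    E (Set.inclusion (projections_subset_psdMatrices n) P) =
      Set.inclusion (projections_subset_psdMatrices n) (naimark P)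

/-- `E` is continuous on each stratum of `S(n)`, a stratum being the set of the matrices of some
fixed rank, with the topology of `ℝ^{n × n}`. -/
def StratumwiseContinuous {n : ℕ} (E : psdMatrices n → psdMatrices n) : Prop :=
  ∀ d : ℕ, ContinuousOn E {A | (A : Matrix (Fin n) (Fin n) ℝ).rank = d}

theorem linearIndepOn_augment {n : ℕ} {V : Type*} [AddCommGroup V] [Module ℝ V] (v : Fin n → V)
    {I J : Set (Fin n)} (hI : LinearIndepOn ℝ v I) (hJ : LinearIndepOn ℝ v J)
    (hIJ : I.ncard < J.ncard) : ∃ e ∈ J, e ∉ I ∧ LinearIndepOn ℝ v (insert e I) := by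
  classical
  by_contra! hcon
  have hsub : Submodule.span ℝ (v '' J) ≤ Submodule.span ℝ (v '' I) := by
    rw [Submodule.span_le]
    rintro _ ⟨e, he, rfl⟩
    by_cases heI : e ∈ I
    · exact Submodule.subset_span ⟨e, heI, rfl⟩
    · by_contra hns
      exact hcon e he heI (hI.insert hns)
  have card : ∀ K : Set (Fin n), LinearIndepOn ℝ v K →
      Module.finrank ℝ (Submodule.span ℝ (v '' K)) = K.ncard := by
    intro K hK
    have h := finrank_span_eq_card (R := ℝ) (b := fun i : K => v i) hK
    rw [← Nat.card_eq_fintype_card, Nat.card_coe_set_eq] at h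
    rw [← h, Set.image_eq_range]
  have : FiniteDimensional ℝ (Submodule.span ℝ (v '' I)) :=
    FiniteDimensional.span_of_finite ℝ (Set.toFinite _)
  have := Submodule.finrank_mono hsub
  rw [card J hJ, card I hI] at this
  omega

/-- The matroid on `{1, …, n}` represented by the sequence of the columns of `A`. A set is
independent if the columns that it indexes are linearly independent (as an indexed family). -/
def colMatroid {n : ℕ} (A : Matrix (Fin n) (Fin n) ℝ) : Matroid (Fin n) :=
  (IndepMatroid.ofFinite (E := Set.univ) Set.finite_univ
    (fun I => LinearIndepOn ℝ A.col I)
    (linearIndepOn_empty ℝ A.col)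
    (fun _ _ hJ hIJ => hJ.mono hIJ)
    (fun _ _ hI hJ h => linearIndepOn_augment A.col hI hJ h)
    (fun _ _ => Set.subset_univ _)).matroid

/-- The bases of `colMatroid A` are the sets that index bases of the span of the columns. -/
theorem colMatroid_isBase_iff {n : ℕ} (A : Matrix (Fin n) (Fin n) ℝ) (B : Set (Fin n)) :
    (colMatroid A).IsBase B ↔ LinearIndepOn ℝ A.col B ∧
      Submodule.span ℝ (A.col '' B) = Submodule.span ℝ (Set.range A.col) := by
  rw [Matroid.isBase_iff_maximal_indep]
  change Maximal (fun I => LinearIndepOn ℝ A.col I) B ↔ _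
  constructor
  · intro h
    refine ⟨h.prop, le_antisymm (Submodule.span_mono (Set.image_subset_range _ _)) ?_⟩
    rw [Submodule.span_le]
    rintro _ ⟨e, rfl⟩
    by_contra hns
    have he := h.le_of_ge (h.prop.insert hns) (Set.subset_insert e B) (Set.mem_insert e B)
    exact hns (Submodule.subset_span ⟨e, he, rfl⟩)
  · rintro ⟨hB, hs⟩
    refine ⟨hB, fun C hC hBC e he => ?_⟩
    have hm : A.col e ∈ Submodule.span ℝ (A.col '' B) := by
      rw [hs]
      exact Submodule.subset_span ⟨e, rfl⟩
    exact hB.mem_span_iff.mp hm (hC.mono (Set.insert_subset he hBC))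

/-- `E` is Gale: the matroid represented by the columns of `E(A)` is the dual of the matroid
represented by the columns of `A`. -/
def IsGale {n : ℕ} (E : psdMatrices n → psdMatrices n) : Prop :=
  ∀ A : psdMatrices n,
    colMatroid (E A : Matrix (Fin n) (Fin n) ℝ) =
      (colMatroid (A : Matrix (Fin n) (Fin n) ℝ)).dual

/-- The largest eigenvalue `λ_max(A)` of a real symmetric matrix. -/
noncomputable def lambdaMax {n : ℕ} (A : Matrix (Fin n) (Fin n) ℝ) : ℝ :=
  sSup (spectrum ℝ A)

/-- The matrix of the orthogonal projection of Euclidean space `ℝⁿ` onto the kernel of `A`. -/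
noncomputable def kernelProjection {n : ℕ} (A : Matrix (Fin n) (Fin n) ℝ) :
    Matrix (Fin n) (Fin n) ℝ :=
  (Matrix.toEuclideanCLM (n := Fin n) (𝕜 := ℝ)).symm
    (Matrix.toEuclideanCLM (n := Fin n) (𝕜 := ℝ) A).ker.starProjection

end NaimarkExt

/-! Obstruction for `n ≥ 3`: take diagonal matrices with one zero entry at `i₀` and positive entries
elsewhere. Every `j ≠ i₀` is a coloop, so a Gale map must send such a matrix to one whose columns
off `i₀` vanish; by symmetry only the entry `(i₀, i₀)` survives. Two free positive entries then give
a map from the plane to the line, continuous by (a) and injective by (b), which cannot exist. For `n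
= 2` only rank 1 occurs, and the adjugate has all three properties.

Property (c) mostly comes from one fact: symmetric matrices with `A * B = 0` and complementary ranks
represent dual matroids (`colMatroid_eq_dual_of_mul_eq_zero`). For (a) and (b), `λ_max I - A`
reflects the spectrum, exchanging its extremes `0` and `λ_max`. For (a) and (c), the kernel
projection is continuous at constant rank because its graph is closed and its values lie in a
compact set. For (b) and (c), no topology is needed: outside `P(n)` all matroid classes have the
cardinality of `ℝ`, so the classes of a matroid and of its dual can be matched by bijections. -/

/-! ### Matroid duality for symmetric matrices spanning each other's kernels -/

open Matrix in
theorem Matrix.range_mulVecLin_eq_ker_of_mul_eq_zero {n : ℕ} {A B : Matrix (Fin n) (Fin n) ℝ}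
    (h : A * B = 0) (hr : A.rank + B.rank = n) :
    LinearMap.range B.mulVecLin = LinearMap.ker A.mulVecLin := by
  apply Submodule.eq_of_le_of_finrank_eq
  · rintro _ ⟨x, rfl⟩
    simp [h]
  · have := A.mulVecLin.finrank_range_add_finrank_ker
    simp only [Module.finrank_fintype_fun_eq_card, Fintype.card_fin] at this
    change A.rank + _ = n at this
    change B.rank = _
    omega

namespace NaimarkExt

open Matrix

theorem colMatroid_ground {n : ℕ} (A : Matrix (Fin n) (Fin n) ℝ) :
    (colMatroid A).E = Set.univ := rfl

theorem finrank_span_image_of_linearIndepOn {n : ℕ} {A : Matrix (Fin n) (Fin n) ℝ}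
    {I : Set (Fin n)} (h : LinearIndepOn ℝ A.col I) :
    Module.finrank ℝ (Submodule.span ℝ (A.col '' I)) = I.ncard := by
  classical
  have h1 := finrank_span_eq_card (R := ℝ) (b := fun i : I => A.col i) h
  rw [← Nat.card_eq_fintype_card, Nat.card_coe_set_eq] at h1
  rw [← h1, Set.image_eq_range]

/-- A relation among the columns of `B` off `I` is a vector `l` in `ker B = range A`, say `l = A y`,
that vanishes on `I`. So `y` is orthogonal to the columns of `A` in `I`, hence to all columns, and
`l = 0`. The rank count turns this independence into a basis. -/
theorem isBase_compl_of_mul_eq_zero {n : ℕ} {A B : Matrix (Fin n) (Fin n) ℝ}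
    (hA : Aᵀ = A) (hB : Bᵀ = B) (h : A * B = 0) (hr : A.rank + B.rank = n)
    {I : Set (Fin n)} (hI : (colMatroid A).IsBase I) : (colMatroid B).IsBase Iᶜ := by
  classical
  obtain ⟨hI1, hI2⟩ := (colMatroid_isBase_iff A I).1 hI
  have hBA : B * A = 0 := by rw [← hA, ← hB, ← transpose_mul, h, transpose_zero]
  have hker := range_mulVecLin_eq_ker_of_mul_eq_zero hBA (by omega)
  have hind : LinearIndepOn ℝ B.col Iᶜ := by
    rw [linearIndepOn_iff]
    intro l hl hl0
    have hBl : B *ᵥ l = 0 := by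
      rw [Finsupp.linearCombination_apply, Finsupp.sum_fintype _ _ (by simp)] at hl0
      ext i
      have h1 := congrFun hl0 i
      simp only [Finset.sum_apply, Pi.smul_apply, smul_eq_mul, col_apply, Pi.zero_apply] at h1
      simpa [mulVec, dotProduct, mul_comm] using h1
    obtain ⟨y, hy⟩ : (l : Fin n → ℝ) ∈ LinearMap.range A.mulVecLin := by
      rw [hker]; exact hBl
    have hspan : ∀ v ∈ Submodule.span ℝ (A.col '' I), v ⬝ᵥ y = 0 := by
      intro v hv
      induction hv using Submodule.span_induction with
      | mem v hv =>
        obtain ⟨i, hi, rfl⟩ := hv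
        have h1 : (A *ᵥ y) i = 0 := by
          have : (A *ᵥ y) i = l i := congrFun hy i
          rw [this]
          by_contra h0
          exact (hl (Finsupp.mem_support_iff.2 h0)) hi
        rw [← h1, mulVec, ← row_transpose, hA]
        rfl
      | zero => simp
      | add u v _ _ hu hv => rw [add_dotProduct, hu, hv, add_zero]
      | smul c v _ hv => rw [smul_dotProduct, hv, smul_zero]
    ext i
    have h1 : (A *ᵥ y) i = l i := congrFun hy i
    rw [← h1, Finsupp.zero_apply, mulVec]
    rw [hI2] at hspan
    have h2 := hspan (A.col i) (Submodule.subset_span ⟨i, rfl⟩)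
    rwa [← row_transpose, hA] at h2
  rw [colMatroid_isBase_iff]
  refine ⟨hind, Submodule.eq_of_le_of_finrank_eq
    (Submodule.span_mono (Set.image_subset_range _ _)) ?_⟩
  have h1 := finrank_span_image_of_linearIndepOn hI1
  rw [hI2, ← rank_eq_finrank_span_cols] at h1
  have h2 := Set.ncard_add_ncard_compl I
  rw [Nat.card_fin] at h2
  rw [finrank_span_image_of_linearIndepOn hind, ← rank_eq_finrank_span_cols]
  omega

/-- Two symmetric matrices, each of which spans the kernel of the other one, represent dual
matroids. -/
theorem colMatroid_eq_dual_of_mul_eq_zero {n : ℕ} {A B : Matrix (Fin n) (Fin n) ℝ}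
    (hA : Aᵀ = A) (hB : Bᵀ = B) (h : A * B = 0) (hr : A.rank + B.rank = n) :
    colMatroid B = (colMatroid A).dual := by
  have hBA : B * A = 0 := by rw [← hA, ← hB, ← transpose_mul, h, transpose_zero]
  refine Matroid.ext_isBase rfl fun I _ => ?_
  rw [Matroid.dual_isBase_iff', colMatroid_ground, ← Set.compl_eq_univ_sdiff,
    and_iff_left (Set.subset_univ _)]
  refine ⟨isBase_compl_of_mul_eq_zero hB hA hBA (by omega), fun hI => ?_⟩
  simpa using isBase_compl_of_mul_eq_zero hA hB h hr hI

/-! ### The orthogonal projection onto the kernel and its continuity -/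

theorem kernelProjection_isStarProjection {n : ℕ} (A : Matrix (Fin n) (Fin n) ℝ) :
    IsStarProjection (kernelProjection A) := by
  have h := isStarProjection_starProjection (𝕜 := ℝ)
    (U := (toEuclideanCLM (n := Fin n) (𝕜 := ℝ) A).ker)
  constructor
  · have h1 := h.isIdempotentElem
    rw [IsIdempotentElem, kernelProjection, ← map_mul, h1.eq]
  · have h1 := h.isSelfAdjoint
    rw [isSelfAdjoint_iff, kernelProjection]
    refine ((toEuclideanCLM (n := Fin n) (𝕜 := ℝ)).symm.map_star' _).symm.trans ?_
    rw [h1.star_eq]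
    rfl

theorem toEuclideanCLM_kernelProjection {n : ℕ} (A : Matrix (Fin n) (Fin n) ℝ) :
    toEuclideanCLM (n := Fin n) (𝕜 := ℝ) (kernelProjection A) =
      (toEuclideanCLM (n := Fin n) (𝕜 := ℝ) A).ker.starProjection :=
  StarAlgEquiv.apply_symm_apply _ _

theorem mul_kernelProjection {n : ℕ} (A : Matrix (Fin n) (Fin n) ℝ) :
    A * kernelProjection A = 0 := by
  apply (toEuclideanCLM (n := Fin n) (𝕜 := ℝ)).injective
  change toEuclideanCLM (n := Fin n) (𝕜 := ℝ) (A * kernelProjection A) =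
    toEuclideanCLM (n := Fin n) (𝕜 := ℝ) 0
  rw [map_mul, map_zero, toEuclideanCLM_kernelProjection]
  ext1 x
  exact Submodule.starProjection_apply_mem (toEuclideanCLM (n := Fin n) (𝕜 := ℝ) A).ker x

theorem kernelProjection_mulVec {n : ℕ} {A : Matrix (Fin n) (Fin n) ℝ} {x : Fin n → ℝ}
    (hx : A *ᵥ x = 0) : kernelProjection A *ᵥ x = x := by
  have h : toEuclideanCLM (n := Fin n) (𝕜 := ℝ) (kernelProjection A) (WithLp.toLp 2 x) =
      WithLp.toLp 2 x := by
    rw [toEuclideanCLM_kernelProjection, Submodule.starProjection_eq_self_iff]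
    change toEuclideanCLM (n := Fin n) (𝕜 := ℝ) A (WithLp.toLp 2 x) = 0
    rw [toEuclideanCLM_toLp, hx, WithLp.toLp_zero]
  rw [toEuclideanCLM_toLp] at h
  exact WithLp.toLp_injective 2 h

theorem kernelProjection_mul {n : ℕ} {A Q : Matrix (Fin n) (Fin n) ℝ} (h : A * Q = 0) :
    kernelProjection A * Q = Q := by
  apply ext_of_mulVec_single
  intro i
  rw [← mulVec_mulVec]
  apply kernelProjection_mulVec
  rw [mulVec_mulVec, h, zero_mulVec]

theorem rank_add_rank_kernelProjection {n : ℕ} (A : Matrix (Fin n) (Fin n) ℝ) :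
    A.rank + (kernelProjection A).rank = n := by
  have h1 : LinearMap.range (kernelProjection A).mulVecLin = LinearMap.ker A.mulVecLin := by
    apply le_antisymm
    · rintro _ ⟨x, rfl⟩
      simp [mul_kernelProjection]
    · intro x hx
      exact ⟨x, kernelProjection_mulVec hx⟩
  have := A.mulVecLin.finrank_range_add_finrank_ker
  rw [← h1] at this
  simpa [rank] using this

theorem trace_eq_rank_of_isStarProjection {n : ℕ} {P : Matrix (Fin n) (Fin n) ℝ}
    (hP : IsStarProjection P) : P.trace = P.rank := by
  have h : LinearMap.IsProj (LinearMap.range P.mulVecLin) P.mulVecLin := by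
    refine ⟨fun x => ⟨x, rfl⟩, ?_⟩
    rintro _ ⟨x, rfl⟩
    simp [hP.isIdempotentElem.eq]
  have h1 := h.trace
  rw [← toLin'_apply', trace_toLin'_eq] at h1
  exact h1

theorem transpose_eq_of_isStarProjection {n : ℕ} {P : Matrix (Fin n) (Fin n) ℝ}
    (hP : IsStarProjection P) : Pᵀ = P := by
  simpa [star_eq_conjTranspose] using hP.isSelfAdjoint.star_eq

/-- With `K` the kernel projection, `K Q = Q K = Q`, so the squared Frobenius norm of `K - Q` is `tr
K - tr Q = 0`. Using the trace of `Q` in place of its rank makes the conditions closed in `(A, Q)`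
once the rank of `A` is fixed. -/
theorem eq_kernelProjection {n : ℕ} {A Q : Matrix (Fin n) (Fin n) ℝ} (hQ : IsStarProjection Q)
    (h : A * Q = 0) (ht : A.rank + Q.trace = n) : Q = kernelProjection A := by
  set K := kernelProjection A with hK
  have hKs : IsStarProjection K := kernelProjection_isStarProjection A
  have hKt := transpose_eq_of_isStarProjection hKs
  have hQt := transpose_eq_of_isStarProjection hQ
  have h1 : K * Q = Q := kernelProjection_mul h
  have h2 : Q * K = Q := by
    conv_lhs => rw [← hKt, ← hQt, ← transpose_mul, h1, hQt]
  have h3 : K.trace = Q.trace := by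
    have := rank_add_rank_kernelProjection A
    rw [trace_eq_rank_of_isStarProjection hKs]
    have h4 : (A.rank : ℝ) + K.rank = n := by exact_mod_cast this
    linarith
  have h5 : ((K - Q)ᴴ * (K - Q)).trace = 0 := by
    rw [conjTranspose_eq_transpose_of_trivial, transpose_sub, hKt, hQt, sub_mul, mul_sub, mul_sub,
      h1, h2, hKs.isIdempotentElem.eq, hQ.isIdempotentElem.eq]
    simp [h3]
  rw [trace_conjTranspose_mul_self_eq_zero_iff, sub_eq_zero] at h5
  exact h5.symm

/-- Idempotence and symmetry give `P i i = ∑ k, P i k ^ 2`, so `P i j ^ 2 ≤ P i i` for all `j`; the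
case `j = i` yields `P i i ≤ 1`. -/
theorem abs_entry_le_one_of_isStarProjection {n : ℕ} {P : Matrix (Fin n) (Fin n) ℝ}
    (hP : IsStarProjection P) (i j : Fin n) : |P i j| ≤ 1 := by
  have hPt := transpose_eq_of_isStarProjection hP
  have key : ∀ i j, P i j ^ 2 ≤ P i i := by
    intro i j
    have h : P i i = ∑ k, P i k ^ 2 := by
      conv_lhs => rw [← hP.isIdempotentElem.eq, mul_apply]
      refine Finset.sum_congr rfl fun k _ => ?_
      have : P k i = P i k := congrFun (congrFun hPt i) k
      rw [this, sq]
    rw [h]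
    exact Finset.single_le_sum (f := fun k => P i k ^ 2) (fun k _ => sq_nonneg _)
      (Finset.mem_univ j)
  have h1 := key i i
  have h2 := key i j
  rw [← sq_le_one_iff_abs_le_one]
  nlinarith

theorem isCompact_setOf_isStarProjection (n : ℕ) :
    IsCompact {P : Matrix (Fin n) (Fin n) ℝ | IsStarProjection P} := by
  have hK : IsCompact (Set.pi Set.univ fun _ : Fin n =>
      Set.pi Set.univ fun _ : Fin n => Set.Icc (-1 : ℝ) 1) :=
    isCompact_univ_pi fun _ => isCompact_univ_pi fun _ => isCompact_Icc
  refine IsCompact.of_isClosed_subset hK ?_ ?_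
  · have : {P : Matrix (Fin n) (Fin n) ℝ | IsStarProjection P} =
        {P | P * P = P} ∩ {P | Pᴴ = P} := by
      ext P
      exact isStarProjection_iff P
    rw [this]
    exact (isClosed_eq (by fun_prop) continuous_id).inter (isClosed_eq (by fun_prop) continuous_id)
  · intro P hP i _ j _
    exact abs_le.1 (abs_entry_le_one_of_isStarProjection hP i j)

/-- The projection onto the kernel depends continuously on a matrix of constant rank. -/
theorem continuousOn_kernelProjection (n d : ℕ) :
    ContinuousOn (kernelProjection (n := n)) {A | A.rank = d} := by
  rw [continuousOn_iff_continuous_domRestrict]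
  let X := {A : Matrix (Fin n) (Fin n) ℝ | A.rank = d}
  let Y := {P : Matrix (Fin n) (Fin n) ℝ | IsStarProjection P}
  have : CompactSpace Y := isCompact_iff_compactSpace.1 (isCompact_setOf_isStarProjection n)
  let f : X → Y := fun A => ⟨kernelProjection A.1, kernelProjection_isStarProjection A.1⟩
  suffices hf : Continuous f from continuous_subtype_val.comp hf
  -- `G` will be the graph of `f`. Projecting along the compact factor `Y` is a closed map, so a
  -- closed graph makes preimages of closed sets closed.
  let G : Set (X × Y) := {p | p.1.1 * p.2.1 = 0 ∧ (d : ℝ) + p.2.1.trace = n}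
  have hG : IsClosed G :=
    (isClosed_eq (by fun_prop) continuous_const).inter
      (isClosed_eq (by fun_prop) continuous_const)
  have hfG : ∀ A P, (A, P) ∈ G ↔ P = f A := by
    intro A P
    have hA : A.1.rank = d := A.2
    constructor
    · rintro ⟨h1, h2⟩
      exact Subtype.ext (eq_kernelProjection P.2 h1 (by rw [hA]; exact h2))
    · rintro rfl
      refine ⟨mul_kernelProjection A.1, ?_⟩
      rw [trace_eq_rank_of_isStarProjection (kernelProjection_isStarProjection A.1), ← hA]
      exact_mod_cast rank_add_rank_kernelProjection A.1
  rw [continuous_iff_isClosed]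
  intro C hC
  have : f ⁻¹' C = Prod.fst '' (G ∩ Prod.snd ⁻¹' C) := by
    ext A
    constructor
    · intro h
      exact ⟨(A, f A), ⟨(hfG _ _).2 rfl, h⟩, rfl⟩
    · rintro ⟨⟨B, P⟩, ⟨h1, h2⟩, rfl⟩
      rw [hfG] at h1
      subst h1
      exact h2
  rw [this]
  exact isClosedMap_fst_of_compactSpace _ (hG.inter (hC.preimage continuous_snd))

/-! ### Rank, spectrum and the largest eigenvalue -/

theorem not_isUnit_of_rank_lt {n : ℕ} {A : Matrix (Fin n) (Fin n) ℝ} (h : A.rank < n) :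
    ¬ IsUnit A := fun hu => by
  rw [rank_of_isUnit A hu, Fintype.card_fin] at h
  exact lt_irrefl n h

theorem rank_lt_of_not_isUnit {n : ℕ} {A : Matrix (Fin n) (Fin n) ℝ} (h : ¬ IsUnit A) :
    A.rank < n := by
  by_contra hn
  have hle : A.rank ≤ n := by simpa using A.rank_le_card_width
  apply h
  rw [← linearIndependent_cols_iff_isUnit,
    linearIndependent_iff_card_eq_finrank_span, Fintype.card_fin, Set.finrank,
    ← rank_eq_finrank_span_cols]
  omega

theorem rank_pos_of_ne_zero {n : ℕ} {A : Matrix (Fin n) (Fin n) ℝ} (h : A ≠ 0) :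
    0 < A.rank := by
  rw [Nat.pos_iff_ne_zero]
  intro h0
  apply h
  rw [rank_eq_finrank_span_cols, Submodule.finrank_eq_zero, Submodule.span_eq_bot] at h0
  ext i j
  exact congrFun (h0 _ ⟨j, rfl⟩) i

theorem zero_mem_spectrum_of_mem_psdMatrices {n : ℕ} {A : Matrix (Fin n) (Fin n) ℝ}
    (hA : A ∈ psdMatrices n) : (0 : ℝ) ∈ spectrum ℝ A :=
  spectrum.zero_mem ℝ (not_isUnit_of_rank_lt hA.2.2)

theorem finite_spectrum {n : ℕ} (A : Matrix (Fin n) (Fin n) ℝ) : (spectrum ℝ A).Finite :=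
  A.finite_real_spectrum

theorem nonneg_of_mem_spectrum {n : ℕ} {A : Matrix (Fin n) (Fin n) ℝ} (hA : A.PosSemidef)
    {r : ℝ} (hr : r ∈ spectrum ℝ A) : 0 ≤ r :=
  (posSemidef_iff_isHermitian_and_spectrum_nonneg.1 hA).2 hr

theorem lambdaMax_mem_spectrum {n : ℕ} {A : Matrix (Fin n) (Fin n) ℝ}
    (hA : A ∈ psdMatrices n) : lambdaMax A ∈ spectrum ℝ A :=
  Set.Nonempty.csSup_mem ⟨0, zero_mem_spectrum_of_mem_psdMatrices hA⟩ (finite_spectrum A)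

theorem le_lambdaMax {n : ℕ} {A : Matrix (Fin n) (Fin n) ℝ} {r : ℝ} (hr : r ∈ spectrum ℝ A) :
    r ≤ lambdaMax A :=
  le_csSup (finite_spectrum A).bddAbove hr

theorem mem_spectrum_smul_one_sub {n : ℕ} {A : Matrix (Fin n) (Fin n) ℝ} {c r : ℝ} :
    r ∈ spectrum ℝ (c • (1 : Matrix (Fin n) (Fin n) ℝ) - A) ↔ c - r ∈ spectrum ℝ A := by
  rw [← Algebra.algebraMap_eq_smul_one, ← spectrum.singleton_sub_eq, Set.singleton_sub]
  constructor
  · rintro ⟨s, hs, rfl⟩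
    simpa using hs
  · intro h
    exact ⟨_, h, by simp⟩

theorem posSemidef_lambdaMax_smul_one_sub {n : ℕ} {A : Matrix (Fin n) (Fin n) ℝ}
    (hA : A.PosSemidef) : (lambdaMax A • (1 : Matrix (Fin n) (Fin n) ℝ) - A).PosSemidef := by
  rw [posSemidef_iff_isHermitian_and_spectrum_nonneg]
  refine ⟨?_, ?_⟩
  · rw [IsHermitian, conjTranspose_sub, conjTranspose_smul, conjTranspose_one, hA.isHermitian.eq,
      star_trivial]
  · intro r hr
    rw [mem_spectrum_smul_one_sub] at hr
    have := le_lambdaMax hr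
    simp only [Set.mem_ofPred_eq]
    linarith

theorem not_isUnit_lambdaMax_smul_one_sub {n : ℕ} {A : Matrix (Fin n) (Fin n) ℝ}
    (hA : A ∈ psdMatrices n) :
    ¬ IsUnit (lambdaMax A • (1 : Matrix (Fin n) (Fin n) ℝ) - A) := by
  rw [← spectrum.zero_mem_iff ℝ, mem_spectrum_smul_one_sub, sub_zero]
  exact lambdaMax_mem_spectrum hA

theorem lambdaMax_smul_one_sub_mem {n : ℕ} {A : Matrix (Fin n) (Fin n) ℝ}
    (hA : A ∈ psdMatrices n) :
    lambdaMax A • (1 : Matrix (Fin n) (Fin n) ℝ) - A ∈ psdMatrices n := by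
  refine ⟨posSemidef_lambdaMax_smul_one_sub hA.1, ?_,
    rank_lt_of_not_isUnit (not_isUnit_lambdaMax_smul_one_sub hA)⟩
  intro h
  rw [sub_eq_zero] at h
  by_cases h0 : lambdaMax A = 0
  · rw [h0, zero_smul] at h
    exact hA.2.1 h.symm
  · apply not_isUnit_of_rank_lt hA.2.2
    rw [← h, ← Algebra.algebraMap_eq_smul_one]
    exact (IsUnit.mk0 _ h0).map (algebraMap ℝ (Matrix (Fin n) (Fin n) ℝ))

theorem lambdaMax_lambdaMax_smul_one_sub {n : ℕ} {A : Matrix (Fin n) (Fin n) ℝ}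
    (hA : A ∈ psdMatrices n) :
    lambdaMax (lambdaMax A • (1 : Matrix (Fin n) (Fin n) ℝ) - A) = lambdaMax A := by
  apply le_antisymm
  · have h := lambdaMax_mem_spectrum (lambdaMax_smul_one_sub_mem hA)
    rw [mem_spectrum_smul_one_sub] at h
    have := nonneg_of_mem_spectrum hA.1 h
    linarith
  · apply le_lambdaMax
    rw [mem_spectrum_smul_one_sub, sub_self]
    exact zero_mem_spectrum_of_mem_psdMatrices hA

theorem lambdaMax_of_mem_projections {n : ℕ} {P : Matrix (Fin n) (Fin n) ℝ}
    (hP : P ∈ projections n) : lambdaMax P = 1 := by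
  have hi := hP.1.isIdempotentElem
  apply le_antisymm
  · have h := lambdaMax_mem_spectrum (projections_subset_psdMatrices n hP)
    rcases hi.spectrum_subset ℝ h with h | h
    · rw [h]; exact zero_le_one
    · exact h.le
  · apply le_lambdaMax
    have h := not_isUnit_of_rank_lt (one_sub_mem_projections hP).2.2
    rw [← spectrum.zero_mem_iff ℝ, ← one_smul ℝ (1 : Matrix (Fin n) (Fin n) ℝ),
      mem_spectrum_smul_one_sub, sub_zero] at h
    exact h

theorem isCompact_setOf_dotProduct_self_eq_one (n : ℕ) :
    IsCompact {x : Fin n → ℝ | x ⬝ᵥ x = 1} := by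
  have hK : IsCompact (Set.pi Set.univ fun _ : Fin n => Set.Icc (-1 : ℝ) 1) :=
    isCompact_univ_pi fun _ => isCompact_Icc
  refine IsCompact.of_isClosed_subset hK
    (isClosed_eq (by fun_prop) continuous_const) ?_
  intro x hx i _
  change x i ∈ Set.Icc (-1 : ℝ) 1
  rw [Set.mem_Icc, ← abs_le, ← sq_le_one_iff_abs_le_one]
  have h : ∑ k, x k * x k = 1 := hx
  rw [← h, sq]
  exact Finset.single_le_sum (f := fun k => x k * x k) (fun k _ => mul_self_nonneg _)
    (Finset.mem_univ i)

/-- This serves continuity: a supremum of a jointly continuous function over a fixed compact set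
varies continuously. A normalized top eigenvector attains the bound. -/
theorem lambdaMax_eq_sSup_rayleigh {n : ℕ} {A : Matrix (Fin n) (Fin n) ℝ}
    (hA : A ∈ psdMatrices n) :
    lambdaMax A = sSup ((fun x => x ⬝ᵥ A *ᵥ x) '' {x : Fin n → ℝ | x ⬝ᵥ x = 1}) := by
  symm
  apply IsGreatest.csSup_eq
  constructor
  · have h := not_isUnit_lambdaMax_smul_one_sub hA
    rw [isUnit_iff_isUnit_det, isUnit_iff_ne_zero, not_not] at h
    obtain ⟨v, hv0, hv⟩ := exists_mulVec_eq_zero_iff.2 h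
    rw [sub_mulVec, smul_mulVec, one_mulVec, sub_eq_zero] at hv
    have hpos : 0 < v ⬝ᵥ v := by
      have := dotProduct_star_self_pos_iff.2 hv0
      simpa using this
    have hs := Real.mul_self_sqrt hpos.le
    have hs0 := (Real.sqrt_pos.2 hpos).ne'
    refine ⟨(√(v ⬝ᵥ v))⁻¹ • v, ?_, ?_⟩
    · simp only [Set.mem_ofPred_eq, smul_dotProduct, dotProduct_smul, smul_eq_mul]
      field_simp
      rw [sq, hs]
    · simp only [mulVec_smul, smul_dotProduct, dotProduct_smul, smul_eq_mul, ← hv]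
      field_simp
      rw [sq, hs, mul_comm]
  · rintro _ ⟨x, hx, rfl⟩
    have h := (posSemidef_lambdaMax_smul_one_sub hA.1).dotProduct_mulVec_nonneg x
    rw [star_trivial, sub_mulVec, smul_mulVec, one_mulVec, dotProduct_sub, dotProduct_smul,
      show x ⬝ᵥ x = 1 from hx] at h
    simp only [smul_eq_mul] at h ⊢
    linarith

theorem continuous_lambdaMax (n : ℕ) :
    Continuous fun A : psdMatrices n => lambdaMax (A : Matrix (Fin n) (Fin n) ℝ) := by
  simp_rw [fun A : psdMatrices n => lambdaMax_eq_sSup_rayleigh A.2]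
  refine (isCompact_setOf_dotProduct_self_eq_one n).continuous_sSup ?_
  fun_prop

end NaimarkExt

/-! ### Cardinality of fibers, lifting involutions, and maps from the plane to the line -/

open Cardinal in
theorem Cardinal.nonempty_equiv_real_of_injective {α : Type*} {f : Set.Ioi (1 : ℝ) → α}
    (hf : Function.Injective f) {g : α → ℝ} (hg : Function.Injective g) : Nonempty (α ≃ ℝ) := by
  have h : Nonempty (ℝ ≃ Set.Ioi (1 : ℝ)) := by
    rw [← Cardinal.eq, Cardinal.mk_real, Cardinal.mk_Ioi_real]
  obtain ⟨e⟩ := h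
  obtain ⟨k, hk⟩ := Function.Embedding.schroeder_bernstein hg (hf.comp e.injective)
  exact ⟨Equiv.ofBijective k hk⟩

/-- If the values of `f` are permuted by an involution and the fibers are all equipotent, then
the involution lifts. -/
theorem exists_involutive_lift {X ι κ : Type*} (f : X → ι) {σ : ι → ι}
    (hσ : Function.Involutive σ) (hne : ∀ x, ∃ y, f y = σ (f x))
    (hf : ∀ x, Nonempty ({y // f y = f x} ≃ κ)) :
    ∃ E : X → X, Function.Involutive E ∧ ∀ x, f (E x) = σ (f x) := by
  have hfib : ∀ i : Set.range f, Nonempty ({y // f y = i.1} ≃ κ) := by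
    rintro ⟨_, x, rfl⟩
    exact hf x
  let e := fun i => (hfib i).some
  -- The coordinate of `x` in its fiber. `E x` will be the point over `σ (f x)` with the same
  -- coordinate, so applying `E` twice restores both fiber and coordinate.
  let c : X → κ := fun x => e ⟨f x, x, rfl⟩ ⟨x, rfl⟩
  have hc : ∀ (i : Set.range f) (y : X) (h : f y = i.1), e i ⟨y, h⟩ = c y := by
    rintro ⟨i, hi⟩ y h
    obtain rfl : f y = i := h
    rfl
  have hE : ∀ x, ∃ y, f y = σ (f x) ∧ c y = c x := by
    intro x
    let i : Set.range f := ⟨σ (f x), hne x⟩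
    let z := (e i).symm (c x)
    refine ⟨z.1, z.2, ?_⟩
    rw [← hc i z.1 z.2]
    exact (e i).apply_symm_apply _
  choose E hE1 hE2 using hE
  refine ⟨E, fun x => ?_, hE1⟩
  have h : f (E (E x)) = f x := by rw [hE1, hE1, hσ]
  have h1 : c (E (E x)) = c x := by rw [hE2, hE2]
  rw [← hc ⟨f x, x, rfl⟩ _ h, ← hc ⟨f x, x, rfl⟩ x rfl] at h1
  exact congrArg Subtype.val ((e _).injective h1)

/-- An injective `f` is strictly monotone on the horizontal axis, so it takes values on both sides
of `f 0`. The punctured plane is connected, hence `f` takes the value `f 0` there again. -/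
theorem not_injective_of_continuous_real_prod {f : ℝ × ℝ → ℝ} (hf : Continuous f) :
    ¬ Function.Injective f := by
  intro hinj
  have hcon : IsPreconnected ({0}ᶜ : Set (ℝ × ℝ)) :=
    (isConnected_compl_singleton_of_one_lt_rank (by
      rw [rank_prod', Module.rank_self, one_add_one_eq_two]
      exact Cardinal.one_lt_two) 0).isPreconnected
  have hmid : ∀ a b : ℝ, a ≠ 0 → b ≠ 0 → f (a, 0) < f 0 → f 0 < f (b, 0) → False := by
    intro a b ha hb h1 h2
    obtain ⟨p, hp, hfp⟩ := hcon.intermediate_value (a := (a, 0)) (b := (b, 0))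
      (by simpa using ha) (by simpa using hb) hf.continuousOn ⟨h1.le, h2.le⟩
    exact hp (hinj hfp)
  have hline : Function.Injective fun t : ℝ => f (t, 0) := fun s t h => by
    simpa using hinj h
  rcases Continuous.strictMono_of_inj (f := fun t : ℝ => f (t, 0)) (by fun_prop) hline with h | h
  · exact hmid (-1) 1 (by norm_num) (by norm_num) (h (by norm_num)) (h (by norm_num))
  · exact hmid 1 (-1) (by norm_num) (by norm_num) (h (by norm_num)) (h (by norm_num))

/-! ### Gale extensions and the involutive one -/

namespace NaimarkExt

open Matrix

theorem transpose_eq_of_mem_psdMatrices {n : ℕ} {A : Matrix (Fin n) (Fin n) ℝ}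
    (hA : A ∈ psdMatrices n) : Aᵀ = A := by
  simpa using hA.1.isHermitian.eq

theorem kernelProjection_mem_projections {n : ℕ} {A : Matrix (Fin n) (Fin n) ℝ}
    (hA : A ∈ psdMatrices n) : kernelProjection A ∈ projections n := by
  have h := rank_add_rank_kernelProjection A
  have h0 := rank_pos_of_ne_zero hA.2.1
  refine ⟨kernelProjection_isStarProjection A, fun hK => ?_, by omega⟩
  have := hA.2.2
  rw [hK, rank_zero] at h
  omega

theorem colMatroid_kernelProjection {n : ℕ} {A : Matrix (Fin n) (Fin n) ℝ}
    (hA : A ∈ psdMatrices n) : colMatroid (kernelProjection A) = (colMatroid A).dual :=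
  colMatroid_eq_dual_of_mul_eq_zero (transpose_eq_of_mem_psdMatrices hA)
    (transpose_eq_of_isStarProjection (kernelProjection_isStarProjection A))
    (mul_kernelProjection A) (rank_add_rank_kernelProjection A)

theorem kernelProjection_of_mem_projections {n : ℕ} {P : Matrix (Fin n) (Fin n) ℝ}
    (hP : P ∈ projections n) : kernelProjection P = 1 - P := by
  symm
  apply eq_kernelProjection hP.1.one_sub hP.1.mul_one_sub_self
  rw [trace_sub, trace_eq_rank_of_isStarProjection hP.1]
  simp

theorem colMatroid_one_sub {n : ℕ} {P : Matrix (Fin n) (Fin n) ℝ} (hP : P ∈ projections n) :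
    colMatroid (1 - P) = (colMatroid P).dual := by
  rw [← kernelProjection_of_mem_projections hP,
    colMatroid_kernelProjection (projections_subset_psdMatrices n hP)]

theorem smul_mem_psdMatrices {n : ℕ} {A : Matrix (Fin n) (Fin n) ℝ} (hA : A ∈ psdMatrices n)
    {c : ℝ} (hc : 0 < c) : c • A ∈ psdMatrices n := by
  refine ⟨hA.1.smul hc.le, smul_ne_zero hc.ne' hA.2.1, rank_lt_of_not_isUnit fun h => ?_⟩
  apply not_isUnit_of_rank_lt hA.2.2
  have h1 := h.smul (Units.mk0 c⁻¹ (inv_ne_zero hc.ne'))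
  rwa [Units.smul_mk0, smul_smul, inv_mul_cancel₀ hc.ne', one_smul] at h1

theorem smul_notMem_projections {n : ℕ} {P : Matrix (Fin n) (Fin n) ℝ} (hP : P ∈ projections n)
    {c : ℝ} (hc : 1 < c) : c • P ∉ projections n := by
  intro h
  have h1 := h.1.isIdempotentElem.eq
  rw [smul_mul_smul_comm, hP.1.isIdempotentElem.eq] at h1
  have h2 := smul_left_injective ℝ hP.2.1 h1
  nlinarith

theorem colMatroid_smul {n : ℕ} (A : Matrix (Fin n) (Fin n) ℝ) {c : ℝ} (hc : c ≠ 0) :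
    colMatroid (c • A) = colMatroid A := by
  have key : ∀ (A : Matrix (Fin n) (Fin n) ℝ) {c : ℝ}, c ≠ 0 → ∀ I,
      LinearIndepOn ℝ A.col I → LinearIndepOn ℝ (c • A).col I := fun A c hc I h =>
    LinearIndependent.units_smul h fun _ => Units.mk0 c hc
  refine Matroid.ext_indep rfl fun I _ => ⟨fun h => ?_, fun h => key A hc I h⟩
  have := key (c • A) (inv_ne_zero hc) I h
  rwa [smul_smul, inv_mul_cancel₀ hc, one_smul] at this

theorem exists_matrix_injective_real (n : ℕ) :
    ∃ g : Matrix (Fin n) (Fin n) ℝ → ℝ, Function.Injective g := by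
  have h : Cardinal.mk (Fin n × Fin n → ℝ) ≤ Cardinal.mk ℝ := by
    rw [← Cardinal.power_def, Cardinal.mk_real]
    refine le_of_le_of_eq ?_ Cardinal.continuum_power_aleph0
    exact Cardinal.power_le_power_left Cardinal.continuum_ne_zero
      (Cardinal.mk_le_aleph0 (α := Fin n × Fin n))
  obtain ⟨g⟩ := h
  exact ⟨fun A => g fun p => A p.1 p.2, fun A B hAB => by
    ext i j
    exact congrFun (g.injective hAB) (i, j)⟩

/-- Double duality gives the projection `P` the matroid of `A`, and the multiples `c • P` with `c >
1` embed a ray in the fiber. -/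
theorem nonempty_colMatroid_fiber_equiv_real {n : ℕ}
    (A : {A : psdMatrices n // A.1 ∉ projections n}) :
    Nonempty ({B : {A : psdMatrices n // A.1 ∉ projections n} //
      colMatroid B.1.1 = colMatroid A.1.1} ≃ ℝ) := by
  have hQ := kernelProjection_mem_projections A.1.2
  have hP := kernelProjection_mem_projections (projections_subset_psdMatrices n hQ)
  set P := kernelProjection (kernelProjection A.1.1)
  have hM : colMatroid P = colMatroid A.1.1 := by
    rw [colMatroid_kernelProjection (projections_subset_psdMatrices n hQ),
      colMatroid_kernelProjection A.1.2, Matroid.dual_dual]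
  obtain ⟨g, hg⟩ := exists_matrix_injective_real n
  refine Cardinal.nonempty_equiv_real_of_injective
    (f := fun c => ⟨⟨⟨c.1 • P, smul_mem_psdMatrices (projections_subset_psdMatrices n hP)
      (zero_lt_one.trans c.2)⟩, smul_notMem_projections hP c.2⟩,
      (colMatroid_smul P (zero_lt_one.trans c.2).ne').trans hM⟩) ?_
    (g := fun B => g B.1.1.1) ?_
  · intro c d h
    simp only [Subtype.mk.injEq] at h
    exact Subtype.ext (smul_left_injective ℝ hP.2.1 h)
  · intro B C h
    exact Subtype.ext (Subtype.ext (Subtype.ext (hg h)))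

theorem exists_involutive_gale_extension (n : ℕ) :
    ∃ E : psdMatrices n → psdMatrices n,
      ExtendsNaimark E ∧ Function.Involutive E ∧ IsGale E := by
  classical
  obtain ⟨F, hF, hFM⟩ := exists_involutive_lift (κ := ℝ)
    (fun A : {A : psdMatrices n // A.1 ∉ projections n} => colMatroid A.1.1)
    (σ := Matroid.dual) (fun M => M.dual_dual)
    (fun A => by
      have hP := kernelProjection_mem_projections A.1.2
      -- The factor 2 takes the projection out of `P(n)` without changing its matroid.
      refine ⟨⟨⟨(2 : ℝ) • kernelProjection A.1.1, smul_mem_psdMatrices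
        (projections_subset_psdMatrices n hP) two_pos⟩,
        smul_notMem_projections hP one_lt_two⟩, ?_⟩
      exact (colMatroid_smul _ two_ne_zero).trans (colMatroid_kernelProjection A.1.2))
    nonempty_colMatroid_fiber_equiv_real
  let E : psdMatrices n → psdMatrices n := fun A =>
    if h : A.1 ∈ projections n then
      ⟨1 - A.1, projections_subset_psdMatrices n (one_sub_mem_projections h)⟩
    else (F ⟨A, h⟩).1
  have hE1 : ∀ A (h : A.1 ∈ projections n), E A =
      ⟨1 - A.1, projections_subset_psdMatrices n (one_sub_mem_projections h)⟩ :=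
    fun A h => dif_pos h
  have hE2 : ∀ A (h : A.1 ∉ projections n), E A = (F ⟨A, h⟩).1 := fun A h => dif_neg h
  refine ⟨E, fun P => hE1 _ P.2, fun A => ?_, fun A => ?_⟩
  · by_cases h : A.1 ∈ projections n
    · rw [hE1 A h, hE1 _ (one_sub_mem_projections h)]
      exact Subtype.ext (sub_sub_cancel 1 A.1)
    · rw [hE2 A h, hE2 _ (F ⟨A, h⟩).2, Subtype.coe_eta, hF]
  · by_cases h : A.1 ∈ projections n
    · rw [hE1 A h]
      exact colMatroid_one_sub h
    · rw [hE2 A h]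
      exact hFM ⟨A, h⟩

/-! ### The adjugate for `n = 2` -/

theorem exists_continuous_involutive_gale_extension_two :
    ∃ E : psdMatrices 2 → psdMatrices 2,
      ExtendsNaimark E ∧ StratumwiseContinuous E ∧ Function.Involutive E ∧ IsGale E := by
  have hadj : ∀ A : Matrix (Fin 2) (Fin 2) ℝ, A.adjugate.adjugate = A := by
    intro A
    ext i j
    fin_cases i <;> fin_cases j <;> simp [adjugate_fin_two]
  have hmem : ∀ A ∈ psdMatrices 2, A.adjugate ∈ psdMatrices 2 := by
    intro A hA
    have hdet : A.det = 0 := by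
      have := not_isUnit_of_rank_lt hA.2.2
      rwa [isUnit_iff_isUnit_det, isUnit_iff_ne_zero, not_not] at this
    refine ⟨?_, fun h => hA.2.1 ?_, rank_lt_of_not_isUnit ?_⟩
    -- For symmetric `A` the adjugate is the conjugate of `A` by a quarter turn, hence positive
    -- semidefinite.
    · have h := hA.1.conjTranspose_mul_mul_same !![0, 1; -1, 0]
      convert h using 1
      have h01 : A 1 0 = A 0 1 :=
        congrFun (congrFun (transpose_eq_of_mem_psdMatrices hA) 0) 1
      ext i j
      fin_cases i <;> fin_cases j <;>
        simp [adjugate_fin_two, mul_apply, Fin.sum_univ_two, h01]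
    · rw [← hadj A, h, adjugate_zero]
    · rw [isUnit_iff_isUnit_det, isUnit_iff_ne_zero, not_not, det_adjugate, hdet]
      simp
  refine ⟨fun A => ⟨A.1.adjugate, hmem A.1 A.2⟩, fun P => ?_, fun d => ?_, fun A => ?_,
    fun A => ?_⟩
  · apply Subtype.ext
    have hr0 := rank_pos_of_ne_zero P.2.2.1
    have hr1 := P.2.2.2
    have htr := trace_eq_rank_of_isStarProjection P.2.1
    -- The adjugate is `tr(P) I - P`, and a rank-one projection has trace 1.
    rw [show P.1.rank = 1 by omega, trace_fin_two, Nat.cast_one] at htr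
    change P.1.adjugate = 1 - P.1
    ext i j
    fin_cases i <;> fin_cases j <;> simp [adjugate_fin_two] <;> linarith
  · exact (Continuous.subtype_mk (continuous_subtype_val.matrix_adjugate) _).continuousOn
  · exact Subtype.ext (hadj A.1)
  · have hA := A.2
    have hB := hmem A.1 A.2
    have hdet : A.1.det = 0 := by
      have := not_isUnit_of_rank_lt hA.2.2
      rwa [isUnit_iff_isUnit_det, isUnit_iff_ne_zero, not_not] at this
    refine colMatroid_eq_dual_of_mul_eq_zero (transpose_eq_of_mem_psdMatrices hA)
      (transpose_eq_of_mem_psdMatrices hB) (by rw [mul_adjugate, hdet, zero_smul]) ?_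
    have h1 := rank_pos_of_ne_zero hA.2.1
    have h2 := rank_pos_of_ne_zero hB.2.1
    have h3 := hA.2.2
    have h4 := hB.2.2
    change A.1.rank + A.1.adjugate.rank = 2
    omega

/-! ### The obstruction for `n ≥ 3` -/

/-- Column `j` is the only column of `diagonal w` with a nonzero `j`-th coordinate, so `j` lies in
every base and is a loop of the dual. -/
theorem col_eq_zero_of_colMatroid_eq_dual_diagonal {n : ℕ} {w : Fin n → ℝ}
    {B : Matrix (Fin n) (Fin n) ℝ} (h : colMatroid B = (colMatroid (diagonal w)).dual)
    {j : Fin n} (hj : w j ≠ 0) : B.col j = 0 := by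
  by_contra h0
  have h1 : (colMatroid B).Indep {j} := LinearIndepOn.singleton h0
  rw [h, Matroid.dual_indep_iff_exists'] at h1
  obtain ⟨-, I, hI, hdis⟩ := h1
  rw [Set.disjoint_singleton_left] at hdis
  have hspan := ((colMatroid_isBase_iff _ I).1 hI).2
  have hv : ∀ v ∈ Submodule.span ℝ ((diagonal w).col '' I), v j = 0 := by
    intro v hv
    induction hv using Submodule.span_induction with
    | mem v hv =>
      obtain ⟨i, hi, rfl⟩ := hv
      exact diagonal_apply_ne _ fun hij => hdis (hij ▸ hi)
    | zero => rfl
    | add u v _ _ hu hv => rw [Pi.add_apply, hu, hv, add_zero]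
    | smul c v _ hv => rw [Pi.smul_apply, hv, smul_zero]
  rw [hspan] at hv
  have := hv _ (Submodule.subset_span ⟨j, rfl⟩)
  rw [col_apply, diagonal_apply_eq] at this
  exact hj this

theorem not_exists_continuous_involutive_gale {n : ℕ} (hn : 3 ≤ n)
    {E : psdMatrices n → psdMatrices n} (hcont : StratumwiseContinuous E)
    (hinv : Function.Involutive E) : ¬ IsGale E := by
  intro hG
  let i₀ : Fin n := ⟨0, by omega⟩
  let i₁ : Fin n := ⟨1, by omega⟩
  let i₂ : Fin n := ⟨2, by omega⟩
  have h10 : i₁ ≠ i₀ := by simp [i₀, i₁]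
  have h20 : i₂ ≠ i₀ := by simp [i₀, i₂]
  have h21 : i₂ ≠ i₁ := by simp [i₁, i₂]
  -- The exponentials keep the two parameters free over all of `ℝ` and the entries positive, so the
  -- family stays in one stratum.
  let w : ℝ × ℝ → Fin n → ℝ := fun p i =>
    if i = i₀ then 0 else if i = i₁ then Real.exp p.1 else if i = i₂ then Real.exp p.2 else 1
  have hw0 : ∀ p, w p i₀ = 0 := fun p => if_pos rfl
  have hw : ∀ p i, i ≠ i₀ → 0 < w p i := by
    intro p i hi
    simp only [w, if_neg hi]
    split_ifs <;> positivity
  have hmem : ∀ p, diagonal (w p) ∈ psdMatrices n := by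
    intro p
    refine ⟨posSemidef_diagonal_iff.2 fun i => ?_, fun h => ?_, rank_lt_of_not_isUnit ?_⟩
    · by_cases hi : i = i₀
      · rw [hi, hw0]
      · exact (hw p i hi).le
    · have h1 := congrFun (congrFun h i₁) i₁
      rw [diagonal_apply_eq] at h1
      exact (hw p i₁ h10).ne' h1
    · rw [isUnit_iff_isUnit_det, isUnit_iff_ne_zero, not_not, det_diagonal]
      exact Finset.prod_eq_zero (Finset.mem_univ i₀) (hw0 p)
  let D : ℝ × ℝ → psdMatrices n := fun p => ⟨diagonal (w p), hmem p⟩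
  have hDc : Continuous D := by
    refine Continuous.subtype_mk (Continuous.matrix_diagonal (continuous_pi fun i => ?_)) _
    simp only [w]
    split_ifs <;> fun_prop
  have hrank : ∀ p, (D p).1.rank = (D 0).1.rank := by
    intro p
    have hne : ∀ q i, w q i ≠ 0 ↔ i ≠ i₀ :=
      fun q i => ⟨fun h hi => h (hi ▸ hw0 q), fun h => (hw q i h).ne'⟩
    simp only [D, rank_diagonal, hne]
  have hEc : Continuous fun p => (E (D p)).1 i₀ i₀ := by
    have h1 : Continuous fun p => E (D p) :=
      (hcont (D 0).1.rank).comp_continuous hDc hrank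
    exact (continuous_subtype_val.comp h1).matrix_elem i₀ i₀
  -- The entry at `(i₀, i₀)` determines `E (D p)`, and `E` is injective, so this entry determines
  -- `p`.
  refine not_injective_of_continuous_real_prod hEc fun p q hpq => ?_
  have hcol : ∀ p i j, j ≠ i₀ → (E (D p)).1 i j = 0 := fun p i j hj =>
    congrFun (col_eq_zero_of_colMatroid_eq_dual_diagonal (hG (D p)) (hw p j hj).ne') i
  have hEE : E (D p) = E (D q) := by
    apply Subtype.ext
    ext i j
    by_cases hj : j = i₀
    · by_cases hi : i = i₀
      · rw [hi, hj]; exact hpq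
      · rw [← transpose_eq_of_mem_psdMatrices (E (D p)).2,
          ← transpose_eq_of_mem_psdMatrices (E (D q)).2, transpose_apply, transpose_apply,
          hcol p j i hi, hcol q j i hi]
    · rw [hcol p i j hj, hcol q i j hj]
  have hDD : diagonal (w p) = diagonal (w q) := congrArg Subtype.val (hinv.injective hEE)
  have hww := diagonal_injective hDD
  have h1 := congrFun hww i₁
  have h2 := congrFun hww i₂
  simp only [w, if_neg h10, if_neg h20, if_neg h21, if_true, Real.exp_eq_exp] at h1 h2
  exact Prod.ext h1 h2

end NaimarkExt

open NaimarkExt in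
theorem theorem1 (n : ℕ) (hn : 2 ≤ n) :
    ((∃ E : NaimarkExt.psdMatrices n → NaimarkExt.psdMatrices n,
        NaimarkExt.ExtendsNaimark E ∧ NaimarkExt.StratumwiseContinuous E ∧
          Function.Involutive E ∧ NaimarkExt.IsGale E) ↔ n = 2) ∧
    (∃ E : NaimarkExt.psdMatrices n → NaimarkExt.psdMatrices n,
        (∀ A : NaimarkExt.psdMatrices n, (E A : Matrix (Fin n) (Fin n) ℝ) =
          NaimarkExt.lambdaMax (A : Matrix (Fin n) (Fin n) ℝ) • (1 : Matrix (Fin n) (Fin n) ℝ)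
            - (A : Matrix (Fin n) (Fin n) ℝ)) ∧
        NaimarkExt.ExtendsNaimark E ∧ NaimarkExt.StratumwiseContinuous E ∧
          Function.Involutive E) ∧
    (∃ E : NaimarkExt.psdMatrices n → NaimarkExt.psdMatrices n,
        (∀ A : NaimarkExt.psdMatrices n, (E A : Matrix (Fin n) (Fin n) ℝ) =
          NaimarkExt.kernelProjection (A : Matrix (Fin n) (Fin n) ℝ)) ∧
        NaimarkExt.ExtendsNaimark E ∧ NaimarkExt.StratumwiseContinuous E ∧
          NaimarkExt.IsGale E) ∧
    (∃ E : NaimarkExt.psdMatrices n → NaimarkExt.psdMatrices n,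
        NaimarkExt.ExtendsNaimark E ∧ Function.Involutive E ∧ NaimarkExt.IsGale E) := by
  refine ⟨⟨?_, ?_⟩, ?_, ?_, exists_involutive_gale_extension n⟩
  · rintro ⟨E, -, hc, hi, hg⟩
    by_contra h
    exact not_exists_continuous_involutive_gale (by omega) hc hi hg
  · rintro rfl
    exact exists_continuous_involutive_gale_extension_two
  · refine ⟨fun A => ⟨_, lambdaMax_smul_one_sub_mem A.2⟩, fun A => rfl, fun P => ?_, fun d => ?_,
      fun A => ?_⟩
    · apply Subtype.ext
      change lambdaMax P.1 • (1 : Matrix (Fin n) (Fin n) ℝ) - P.1 = 1 - P.1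
      rw [lambdaMax_of_mem_projections P.2, one_smul]
    · refine (Continuous.subtype_mk ?_ _).continuousOn
      exact ((continuous_lambdaMax n).smul continuous_const).sub continuous_subtype_val
    · apply Subtype.ext
      change lambdaMax (lambdaMax A.1 • (1 : Matrix (Fin n) (Fin n) ℝ) - A.1) •
        (1 : Matrix (Fin n) (Fin n) ℝ) - (lambdaMax A.1 • 1 - A.1) = A.1
      rw [lambdaMax_lambdaMax_smul_one_sub A.2, sub_sub_cancel]
  · refine ⟨fun A => ⟨_, projections_subset_psdMatrices n (kernelProjection_mem_projections A.2)⟩,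
      fun A => rfl, fun P => ?_, fun d => ?_, fun A => colMatroid_kernelProjection A.2⟩
    · exact Subtype.ext (kernelProjection_of_mem_projections P.2)
    · rw [Topology.IsInducing.subtypeVal.continuousOn_iff]
      exact (continuousOn_kernelProjection n d).comp continuous_subtype_val.continuousOn
        fun A hA => hA
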